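/- Let $A$ be a $C^*$-algebra and let $X$ be an $A$-correspondence, i.e. a right Hilbert $A$-module with a $*$-homomorphism $\varphi\colon A\to\mathcal L(X)$ into the adjointable operators; write $ax=\varphi(a)x$. Let $\mathcal K(X)$ be the closed linear span of the operators $\theta_{x,y}z=x\langle y,z\rangle_A$, and let $J_X=\varphi^{-1}(\mathcal K(X))\cap(\ker\varphi)^\perp$, where $(\ker\varphi)^\perp=\{a\in A: ab=0\text{ for all }b\in\ker\varphi\}$. Assume that $X$ is nondegenerate, $\varphi(A)X=X$, and regular, $J_X=A$ (that is, $A$ acts faithfully by compact operators on $X$). Let $\mathcal H$ be a complex Hilbert space. A representation of $X$ on $\mathcal H$ is a pair $(\psi,\pi)$ of a linear map $\psi\colon X\to B(\mathcal H)$ and a $*$-homomorphism $\pi\colon A\to B(\mathcal H)$ with $\psi(ax)=\pi(a)\psi(x)$ and $\psi(x)^*\psi(y)=\pi(\langle x,y\rangle_A)$ for all $a\in A$, $x,y\in X$. It is nondegenerate if the $C^*$-algebra generated by $\psi(X)\cup\pi(A)$ acts nondegenerately on $\mathcal H$, and Cuntz–Pimsner covariant if $\pi(a)=\psi^{(1)}(\varphi(a))$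 for all $a\in J_X$, where $\psi^{(1)}\colon\mathcal K(X)\to B(\mathcal H)$ is the unique $*$-homomorphism with $\psi^{(1)}(\theta_{x,y})=\psi(x)\psi(y)^*$. For a representation ($*$-homomorphism) $\pi\colon A\to B(\mathcal H)$, let $X\otimes_A\mathcal H$ be the Hilbert space completion of $X\odot\mathcal H$ (modulo null vectors) for $\langle x\otimes\xi,y\otimes\eta\rangle=\langle\xi,\pi(\langle x,y\rangle_A)\eta\rangle$ (inner products linear in the second variable), and let $X\text{-}\mathrm{Ind}\,\pi$ be the representation of $A$ on it given by $(X\text{-}\mathrm{Ind}\,\pi)(a)(x\otimes_A\xi)=ax\otimes_A\xi$. Then the formula $$V(x\otimes_A\xi)=\psi(x)\xi\qquad(x\in X,\ \xi\in\mathcal H)$$ defines a bijection $(\psi,\pi)\mapsto(\pi,V)$ from the set of nondegenerate Cuntz–Pimsner covariant representations of $X$ on $\mathcal H$ onto the set of pairs $(\pi,V)$, where $\pi$ is a representation of $A$ on $\mathcal H$ and $V\colon X\otimes_A\mathcal H\to\mathcal H$ is a unitary with $V\,(X\text{-}\mathrm{Ind}\,\pi)(a)=\pi(a)\,V$ for all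 $a\in A$. -/

import Mathlib

open scoped InnerProductSpace RightActions TensorProduct

noncomputable section

namespace CStarCorr

set_option linter.unusedSectionVars false

/-! ### Right Hilbert modules

A right Hilbert `A`-module `X` is a Hilbert module `CStarModule Aᵐᵒᵖ X` in the sense of Mathlib: the
right action of `a : A` on `x : X` is `x <• a = MulOpposite.op a • x`. The complete norm of `X` is
`‖x‖ = √‖⟨x, x⟩‖`, by a field of `CStarModule`. -/

section HilbertModule

variable (A : Type*) [NonUnitalCStarAlgebra A] [PartialOrder A]
variable {X : Type*} [NormedAddCommGroup X] [NormedSpace ℂ X] [SMul Aᵐᵒᵖ X] [CStarModule Aᵐᵒᵖ X]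

/-- The `A`-valued inner product `⟨x, y⟩` of a right Hilbert `A`-module; it is conjugate-linear in
`x`, linear in `y`, and `⟨x, y <• a⟩ = ⟨x, y⟩ * a`. -/
def ip (x y : X) : A := MulOpposite.unop (inner Aᵐᵒᵖ x y)

theorem ip_add_right (x y z : X) : ip A x (y + z) = ip A x y + ip A x z := by simp [ip]

theorem ip_add_left (x y z : X) : ip A (x + y) z = ip A x z + ip A y z := by simp [ip]

theorem ip_smul_right (c : ℂ) (x y : X) : ip A x (c • y) = c • ip A x y := by simp [ip]

theorem ip_smul_left (c : ℂ) (x y : X) : ip A (c • x) y = star c • ip A x y := by simp [ip]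

theorem star_ip (x y : X) : star (ip A x y) = ip A y x := by
  rw [ip, ← MulOpposite.unop_star, CStarModule.star_inner, ip]

theorem ip_op_smul_right (x y : X) (a : A) : ip A x (y <• a) = ip A x y * a := by simp [ip]

theorem ip_op_smul_left (x y : X) (a : A) : ip A (x <• a) y = star a * ip A x y := by
  rw [← star_ip, ip_op_smul_right, star_mul, star_ip]

theorem ip_self_nonneg (x : X) : 0 ≤ ip A x x :=
  (CStarModule.inner_self_nonneg (A := Aᵐᵒᵖ) (x := x))

theorem ip_self_eq_zero {x : X} (h : ip A x x = 0) : x = 0 :=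
  (CStarModule.inner_self (A := Aᵐᵒᵖ)).1 (MulOpposite.unop_injective h)

variable [StarOrderedRing A] in
theorem norm_ip_le (x y : X) : ‖ip A x y‖ ≤ ‖x‖ * ‖y‖ :=
  CStarModule.norm_inner_le (A := Aᵐᵒᵖ) X

theorem norm_sq_eq (x : X) : ‖x‖ ^ 2 = ‖ip A x x‖ := CStarModule.norm_sq_eq (A := Aᵐᵒᵖ)

theorem ip_sub_right (x y z : X) : ip A x (y - z) = ip A x y - ip A x z := by simp [ip]

theorem ip_zero_left (x : X) : ip A 0 x = 0 := by simp [ip]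

theorem ip_zero_right (x : X) : ip A x 0 = 0 := by simp [ip]

theorem ip_ext {x y : X} (h : ∀ z, ip A z x = ip A z y) : x = y := by
  refine sub_eq_zero.1 (ip_self_eq_zero A ?_)
  rw [ip_sub_right, h, sub_self]

theorem ip_sum_right {ι : Type*} (s : Finset ι) (x : X) (y : ι → X) :
    ip A x (∑ i ∈ s, y i) = ∑ i ∈ s, ip A x (y i) := by
  simp [ip]

theorem ip_sum_left {ι : Type*} (s : Finset ι) (x : ι → X) (y : X) :
    ip A (∑ i ∈ s, x i) y = ∑ i ∈ s, ip A (x i) y := by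
  simp [ip]

variable [StarOrderedRing A] in
theorem continuous_ip : Continuous fun p : X × X => ip A p.1 p.2 :=
  MulOpposite.continuous_unop.comp (CStarModule.continuous_inner (A := Aᵐᵒᵖ) (E := X))

theorem norm_op_smul_le (x : X) (a : A) : ‖x <• a‖ ≤ ‖x‖ * ‖a‖ := by
  refine abs_le_of_sq_le_sq' ?_ (by positivity) |>.2
  rw [norm_sq_eq A, ip_op_smul_right, ip_op_smul_left]
  calc ‖star a * ip A x x * a‖ ≤ ‖star a‖ * ‖ip A x x‖ * ‖a‖ :=
        (norm_mul_le _ _).trans (by gcongr; exact norm_mul_le _ _)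
    _ = (‖x‖ * ‖a‖) ^ 2 := by rw [norm_star, ← norm_sq_eq]; ring

/-! ### Adjointable operators and generalized compact operators -/

variable (X) in
/-- The operators on the right Hilbert `A`-module `X` that have an adjoint. -/
def adjointableSubalgebra : Subalgebra ℂ (X →L[ℂ] X) where
  carrier := {T | ∃ S : X →L[ℂ] X, ∀ x y, ip A (T x) y = ip A x (S y)}
  mul_mem' := by
    rintro T₁ T₂ ⟨S₁, h₁⟩ ⟨S₂, h₂⟩
    exact ⟨S₂ * S₁, fun x y => by simp [h₁, h₂]⟩
  add_mem' := by
    rintro T₁ T₂ ⟨S₁, h₁⟩ ⟨S₂, h₂⟩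
    exact ⟨S₁ + S₂, fun x y => by simp [h₁, h₂, ip_add_left, ip_add_right]⟩
  algebraMap_mem' c :=
    ⟨star c • 1, fun x y => by
      simp [Algebra.algebraMap_eq_smul_one, ip_smul_left, ip_smul_right]⟩

variable (X) in
/-- The algebra `ℒ(X)` of adjointable operators on the right Hilbert `A`-module `X`, with the
operator norm; the involution is defined below. -/
def Adjointable : Type _ := adjointableSubalgebra A X

variable {A}

/-- The bounded operator underlying an adjointable operator. -/
def Adjointable.toCLM (T : Adjointable A X) : X →L[ℂ] X := Subtype.val T

instance : CoeFun (Adjointable A X) fun _ => X → X := ⟨fun T => T.toCLM⟩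

instance : NormedRing (Adjointable A X) :=
  inferInstanceAs (NormedRing (adjointableSubalgebra A X))

instance : NormedAlgebra ℂ (Adjointable A X) :=
  inferInstanceAs (NormedAlgebra ℂ (adjointableSubalgebra A X))

theorem Adjointable.ext {S T : Adjointable A X} (h : ∀ x, S x = T x) : S = T :=
  Subtype.ext (ContinuousLinearMap.ext h)

theorem add_apply (S T : Adjointable A X) (x : X) : (S + T) x = S x + T x := rfl

theorem sub_apply (S T : Adjointable A X) (x : X) : (S - T) x = S x - T x := rfl

theorem zero_apply (x : X) : (0 : Adjointable A X) x = 0 := rfl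

theorem one_apply (x : X) : (1 : Adjointable A X) x = x := rfl

theorem mul_apply (S T : Adjointable A X) (x : X) : (S * T) x = S (T x) := rfl

theorem smul_apply (c : ℂ) (T : Adjointable A X) (x : X) : (c • T) x = c • T x := rfl

theorem norm_toCLM (T : Adjointable A X) : ‖T.toCLM‖ = ‖T‖ := rfl

theorem norm_apply_le (T : Adjointable A X) (x : X) : ‖T x‖ ≤ ‖T‖ * ‖x‖ := T.toCLM.le_opNorm x

theorem isometry_toCLM : Isometry (Adjointable.toCLM : Adjointable A X → X →L[ℂ] X) :=
  Isometry.of_dist_eq fun _ _ => rfl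

theorem adj_unique {T S S' : X → X} (h : ∀ x y, ip A (T x) y = ip A x (S y))
    (h' : ∀ x y, ip A (T x) y = ip A x (S' y)) (y : X) : S y = S' y :=
  ip_ext A fun z => by rw [← h, ← h']

/-- The adjoint `T⋆` of `T ∈ ℒ(X)`: the operator with `⟨T x, y⟩ = ⟨x, T⋆ y⟩` for all `x`, `y`. -/
instance : Star (Adjointable A X) where
  star T := ⟨T.2.choose, T.toCLM, fun x y => by
    rw [← star_ip, ← T.2.choose_spec, star_ip, Adjointable.toCLM]⟩

theorem ip_adj_right (T : Adjointable A X) (x y : X) : ip A (T x) y = ip A x (star T y) :=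
  T.2.choose_spec x y

theorem ip_adj_left (T : Adjointable A X) (x y : X) : ip A (star T x) y = ip A x (T y) := by
  rw [← star_ip, ← ip_adj_right, star_ip]

theorem star_eq_of_ip {T S : Adjointable A X} (h : ∀ x y, ip A (T x) y = ip A x (S y)) :
    star T = S := Adjointable.ext (adj_unique (ip_adj_right T) h)

instance : StarRing (Adjointable A X) where
  star_involutive T := star_eq_of_ip (ip_adj_left T)
  star_mul S T := star_eq_of_ip fun x y => by simp only [mul_apply, ip_adj_right]
  star_add S T := star_eq_of_ip fun x y => by
    simp only [add_apply, ip_adj_right, ip_add_left, ip_add_right]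

instance : StarModule ℂ (Adjointable A X) where
  star_smul c T := star_eq_of_ip fun x y => by
    simp only [smul_apply, ip_adj_right, ip_smul_left, ip_smul_right]

variable [StarOrderedRing A]

theorem norm_sq_le_norm_star_mul_self (T : Adjointable A X) : ‖T‖ * ‖T‖ ≤ ‖star T * T‖ := by
  have h : ‖T‖ ≤ √‖star T * T‖ := by
    refine ContinuousLinearMap.opNorm_le_bound T.toCLM (by positivity) fun x => ?_
    refine abs_le_of_sq_le_sq' ?_ (by positivity) |>.2
    rw [norm_sq_eq A, ip_adj_right, mul_pow, Real.sq_sqrt (norm_nonneg _)]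
    calc _ ≤ ‖x‖ * ‖(star T * T) x‖ := norm_ip_le A _ _
      _ ≤ ‖x‖ * (‖star T * T‖ * ‖x‖) := by gcongr; exact norm_apply_le _ x
      _ = _ := by ring
  calc ‖T‖ * ‖T‖ ≤ √‖star T * T‖ * √‖star T * T‖ := by gcongr
    _ = _ := Real.mul_self_sqrt (norm_nonneg _)

instance : CStarRing (Adjointable A X) where
  norm_mul_self_le := norm_sq_le_norm_star_mul_self

instance [CompleteSpace X] : CompleteSpace (Adjointable A X) := by
  refine Metric.complete_of_cauchySeq_tendsto fun u hu => ?_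
  have hs : CauchySeq fun n => star (u n) := by
    rw [Metric.cauchySeq_iff] at hu ⊢
    intro ε hε
    obtain ⟨N, hN⟩ := hu ε hε
    refine ⟨N, fun m hm n hn => ?_⟩
    rw [dist_eq_norm, ← star_sub, norm_star, ← dist_eq_norm]
    exact hN m hm n hn
  obtain ⟨T, hT⟩ := cauchySeq_tendsto_of_complete
    (isometry_toCLM.uniformContinuous.comp_cauchySeq hu)
  obtain ⟨S, hS⟩ := cauchySeq_tendsto_of_complete
    (isometry_toCLM.uniformContinuous.comp_cauchySeq hs)
  have key : ∀ x y, ip A (T x) y = ip A x (S y) := fun x y => by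
    have h1 : Filter.Tendsto (fun n => ip A (u n x) y) Filter.atTop (nhds (ip A (T x) y)) :=
      ((continuous_ip A).tendsto (T x, y)).comp
        ((((ContinuousLinearMap.apply ℂ X x).continuous.tendsto T).comp hT).prodMk_nhds
          tendsto_const_nhds)
    have h2 : Filter.Tendsto (fun n => ip A x (star (u n) y)) Filter.atTop
        (nhds (ip A x (S y))) :=
      ((continuous_ip A).tendsto (x, S y)).comp
        (tendsto_const_nhds.prodMk_nhds
          (((ContinuousLinearMap.apply ℂ X y).continuous.tendsto S).comp hS))
    exact tendsto_nhds_unique h1 (by simpa only [ip_adj_right] using h2)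
  exact ⟨⟨T, S, key⟩, isometry_toCLM.isEmbedding.tendsto_nhds_iff.2 hT⟩

instance [CompleteSpace X] : CStarAlgebra (Adjointable A X) where

/-- The generalized rank-one operator `θ_{x,y} z = x <• ⟨y, z⟩`, as a bounded operator. -/
def rankOneCLM (A : Type*) [NonUnitalCStarAlgebra A] [PartialOrder A] [StarOrderedRing A]
    {X : Type*} [NormedAddCommGroup X] [NormedSpace ℂ X] [SMul Aᵐᵒᵖ X] [CStarModule Aᵐᵒᵖ X]
    (x y : X) : X →L[ℂ] X :=
  LinearMap.mkContinuous
    { toFun := fun z => x <• ip A y z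
      map_add' := fun z w => ip_ext A fun v => by
        simp only [ip_op_smul_right, ip_add_right, mul_add]
      map_smul' := fun c z => ip_ext A fun v => by
        simp only [ip_op_smul_right, ip_smul_right, mul_smul_comm, RingHom.id_apply] }
    (‖x‖ * ‖y‖) fun z => by
      refine (norm_op_smul_le A _ _).trans ?_
      rw [mul_assoc]
      gcongr
      exact norm_ip_le A y z

theorem ip_rankOneCLM (x y z w : X) :
    ip A (rankOneCLM A x y z) w = ip A z (rankOneCLM A y x w) := by
  change ip A (x <• ip A y z) w = ip A z (y <• ip A x w)
  rw [ip_op_smul_left, ip_op_smul_right, star_ip]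

variable (A) in
/-- The generalized rank-one operator `θ_{x,y} ∈ ℒ(X)`, `θ_{x,y} z = x <• ⟨y, z⟩`. -/
def rankOne (x y : X) : Adjointable A X :=
  ⟨rankOneCLM A x y, rankOneCLM A y x, ip_rankOneCLM x y⟩

theorem rankOne_apply (x y z : X) : rankOne A x y z = x <• ip A y z := rfl

theorem star_rankOne (x y : X) : star (rankOne A x y) = rankOne A y x :=
  star_eq_of_ip (ip_rankOneCLM x y)

theorem rankOne_mul (x y z w : X) :
    rankOne A x y * rankOne A z w = rankOne A (x <• ip A y z) w := by
  refine Adjointable.ext fun v => ip_ext A fun u => ?_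
  change ip A u (x <• ip A y (z <• ip A w v)) = ip A u ((x <• ip A y z) <• ip A w v)
  simp only [ip_op_smul_right, mul_assoc]

variable (A X) in
/-- The linear span of the rank-one operators, a `*`-subalgebra of `ℒ(X)`. -/
def finiteRank : NonUnitalStarSubalgebra ℂ (Adjointable A X) where
  __ := Submodule.span ℂ (Set.range fun p : X × X => rankOne A p.1 p.2)
  mul_mem' {S T} hS hT := by
    have hST := Submodule.mul_mem_mul hS hT
    rw [Submodule.span_mul_span] at hST
    refine Submodule.span_mono ?_ hST
    rintro _ ⟨_, ⟨p, rfl⟩, _, ⟨q, rfl⟩, rfl⟩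
    exact ⟨(p.1 <• ip A p.2 q.1, q.2), (rankOne_mul _ _ _ _).symm⟩
  star_mem' {T} hT := by
    change star T ∈ Submodule.span ℂ _
    refine Submodule.span_induction ?_ ?_ ?_ ?_ hT
    · rintro _ ⟨p, rfl⟩
      exact Submodule.subset_span ⟨(p.2, p.1), (star_rankOne _ _).symm⟩
    · simp
    · intro S T _ _ hS hT
      rw [star_add]
      exact add_mem hS hT
    · intro c T _ hT
      rw [star_smul]
      exact Submodule.smul_mem _ _ hT

variable (A X) in
/-- The algebra `𝒦(X)` of generalized compact operators: the closed linear span in `ℒ(X)` of the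
rank-one operators. -/
def Compacts : NonUnitalStarSubalgebra ℂ (Adjointable A X) := (finiteRank A X).topologicalClosure

theorem rankOne_mem (x y : X) : rankOne A x y ∈ Compacts A X :=
  (finiteRank A X).le_topologicalClosure (Submodule.subset_span ⟨(x, y), rfl⟩)

variable (A) in
/-- The rank-one operator `θ_{x,y}` as an element of `𝒦(X)`. -/
def theta (x y : X) : Compacts A X := ⟨rankOne A x y, rankOne_mem x y⟩

end HilbertModule

/-! ### The Hilbert space `X ⊗_A ℋ` and induced representations -/

section Induction

variable {A : Type*} [NonUnitalCStarAlgebra A] [PartialOrder A] [StarOrderedRing A]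
variable {X : Type*} [NormedAddCommGroup X] [NormedSpace ℂ X] [SMul Aᵐᵒᵖ X] [CStarModule Aᵐᵒᵖ X]
variable {H : Type*} [NormedAddCommGroup H] [InnerProductSpace ℂ H] [CompleteSpace H]

theorem exists_pos_neg {B : Type*} [NonUnitalCStarAlgebra B] [PartialOrder B] [StarOrderedRing B]
    {M : B} (hM : IsSelfAdjoint M) : ∃ P N : B, M = P - N ∧ N * P = 0 ∧ 0 ≤ P ∧ 0 ≤ N :=
  ⟨M⁺, M⁻, (CFC.posPart_sub_negPart M hM).symm, CFC.negPart_mul_posPart M,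
    CFC.posPart_nonneg M, CFC.negPart_nonneg M⟩

theorem nonneg_factor {B : Type*} [NonUnitalCStarAlgebra B] [PartialOrder B] [StarOrderedRing B]
    {M : B} (hM : 0 ≤ M) : ∃ C : B, M = star C * C :=
  CStarAlgebra.nonneg_iff_eq_star_mul_self.1 hM

/-- The Gram matrix `(⟨x i, x j⟩)` is of the form `B⋆ B`. -/
theorem gram_eq {n : ℕ} (x : Fin n → X) : ∃ B : Fin n → Fin n → A,
    ∀ i j, ip A (x i) (x j) = ∑ k, star (B k i) * B k j := by
  set M : CStarMatrix (Fin n) (Fin n) A := CStarMatrix.ofMatrix fun i j => ip A (x i) (x j) with hM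
  have hMij : ∀ i j, M i j = ip A (x i) (x j) := fun i j => rfl
  have hsa : IsSelfAdjoint M := by
    refine CStarMatrix.ext fun i j => ?_
    rw [CStarMatrix.star_apply, hMij, hMij, star_ip]
  suffices h0 : 0 ≤ M by
    obtain ⟨B, hB⟩ := nonneg_factor h0
    refine ⟨fun i j => B i j, fun i j => ?_⟩
    rw [← hMij, hB, CStarMatrix.mul_apply]
    simp only [CStarMatrix.star_apply]
  obtain ⟨P, N, hMPN, hNP, hP0, hN0⟩ := exists_pos_neg hsa
  have hNs : star N = N := (IsSelfAdjoint.of_nonneg hN0).star_eq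
  have hNMN : N * M * N = -(N * N * N) := by
    rw [hMPN, mul_sub, hNP, zero_sub, neg_mul]
  obtain ⟨C, hC⟩ : ∃ C, N * N * N = star C * C := by
    refine nonneg_factor ?_
    have := star_left_conjugate_nonneg hN0 N
    rwa [hNs] at this
  have hC0 : C = 0 := by
    refine CStarMatrix.ext (M₂ := 0) fun k j => ?_
    have hpos : 0 ≤ (N * M * N) j j := by
      have : (N * M * N) j j = ip A (∑ k, x k <• N k j) (∑ k, x k <• N k j) := by
        rw [CStarMatrix.mul_apply, ip_sum_right]
        refine Finset.sum_congr rfl fun l _ => ?_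
        rw [ip_op_smul_right, CStarMatrix.mul_apply, ip_sum_left]
        congr 1
        refine Finset.sum_congr rfl fun m _ => ?_
        rw [ip_op_smul_left, hMij, ← CStarMatrix.star_apply, hNs]
      rw [this]
      exact ip_self_nonneg A _
    rw [hNMN, hC, CStarMatrix.neg_apply, CStarMatrix.mul_apply] at hpos
    simp only [CStarMatrix.star_apply] at hpos
    have hsum : ∑ k, star (C k j) * C k j = 0 :=
      le_antisymm (neg_nonneg.1 hpos) (Finset.sum_nonneg fun k _ => star_mul_self_nonneg _)
    have := (Finset.sum_eq_zero_iff_of_nonneg fun k _ => star_mul_self_nonneg (C k j)).1 hsum k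
      (Finset.mem_univ k)
    exact (CStarRing.star_mul_self_eq_zero_iff _).1 this
  have hN3 : N * N * N = 0 := by rw [hC, hC0, mul_zero]
  have hN2 : N * N = 0 := by
    refine (CStarRing.star_mul_self_eq_zero_iff _).1 ?_
    rw [star_mul, hNs, ← mul_assoc, hN3, zero_mul]
  have hN : N = 0 := (CStarRing.star_mul_self_eq_zero_iff _).1 (by rw [hNs, hN2])
  rw [hMPN, hN, sub_zero]
  exact hP0

variable (X) in
/-- The algebraic tensor product `X ⊗_ℂ ℋ`, remembering the representation `π` of `A` on `ℋ`, which
determines its semi-inner product `⟪x ⊗ ξ, y ⊗ η⟫ = ⟪ξ, π ⟨x, y⟩ η⟫`. -/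
@[nolint unusedArguments]
def PreTensor (_π : A →⋆ₙₐ[ℂ] (H →L[ℂ] H)) : Type _ := X ⊗[ℂ] H

variable (π : A →⋆ₙₐ[ℂ] (H →L[ℂ] H))

instance : AddCommGroup (PreTensor X π) := inferInstanceAs (AddCommGroup (X ⊗[ℂ] H))
instance : Module ℂ (PreTensor X π) := inferInstanceAs (Module ℂ (X ⊗[ℂ] H))

/-- The elementary tensor `x ⊗ ξ` in the algebraic tensor product. -/
def preTmul (x : X) (ξ : H) : PreTensor X π := (x ⊗ₜ[ℂ] ξ : X ⊗[ℂ] H)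

/-- The linear functional `⟪x ⊗ ξ, ·⟫` on the algebraic tensor product. -/
def formAux (x : X) (ξ : H) : X ⊗[ℂ] H →ₗ[ℂ] ℂ :=
  TensorProduct.lift (LinearMap.mk₂ ℂ (fun y η => ⟪ξ, π (ip A x y) η⟫_ℂ)
    (fun y z η => by simp [ip_add_right])
    (fun c y η => by simp [ip_smul_right])
    (fun y η ζ => by simp)
    (fun c y η => by simp))

theorem formAux_tmul (x : X) (ξ : H) (y : X) (η : H) :
    formAux π x ξ (y ⊗ₜ[ℂ] η) = ⟪ξ, π (ip A x y) η⟫_ℂ := rfl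

/-- The sesquilinear form with `⟪x ⊗ ξ, y ⊗ η⟫ = ⟪ξ, π ⟨x, y⟩ η⟫`, on `X ⊗_ℂ ℋ`. -/
def formTensor : X ⊗[ℂ] H →ₗ⋆[ℂ] X ⊗[ℂ] H →ₗ[ℂ] ℂ :=
  TensorProduct.lift (LinearMap.mk₂'ₛₗ (starRingEnd ℂ) (starRingEnd ℂ) (formAux (X := X) π)
    (fun x y ξ => TensorProduct.ext' fun z ζ => by
      rw [LinearMap.add_apply]
      simp only [formAux_tmul, ip_add_left, map_add, _root_.add_apply,
        inner_add_right])
    (fun c x ξ => TensorProduct.ext' fun z ζ => by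
      rw [LinearMap.smul_apply]
      simp only [formAux_tmul, ip_smul_left, map_smul, _root_.smul_apply,
        inner_smul_right]
      rfl)
    (fun x ξ η => TensorProduct.ext' fun z ζ => by
      rw [LinearMap.add_apply]
      simp only [formAux_tmul, inner_add_left])
    (fun c x ξ => TensorProduct.ext' fun z ζ => by
      rw [LinearMap.smul_apply]
      simp only [formAux_tmul, inner_smul_left]
      rfl))

/-- The sesquilinear form with `⟪x ⊗ ξ, y ⊗ η⟫ = ⟪ξ, π ⟨x, y⟩ η⟫`. -/
def form : PreTensor X π →ₗ⋆[ℂ] PreTensor X π →ₗ[ℂ] ℂ := formTensor π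

theorem form_tmul (x : X) (ξ : H) (y : X) (η : H) :
    form π (preTmul π x ξ) (preTmul π y η) = ⟪ξ, π (ip A x y) η⟫_ℂ := rfl

variable {π} in
@[elab_as_elim]
theorem PreTensor.induction {p : PreTensor X π → Prop} (u : PreTensor X π) (h0 : p 0)
    (h1 : ∀ x ξ, p (preTmul π x ξ)) (h2 : ∀ u v, p u → p v → p (u + v)) : p u :=
  TensorProduct.induction_on (motive := p) u h0 h1 h2

theorem PreTensor.exists_sum (u : PreTensor X π) :
    ∃ (n : ℕ) (x : Fin n → X) (ξ : Fin n → H), u = ∑ i, preTmul π (x i) (ξ i) := by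
  refine PreTensor.induction u ⟨0, Fin.elim0, Fin.elim0, by simp⟩
    (fun x ξ => ⟨1, fun _ => x, fun _ => ξ, by simp⟩) ?_
  rintro _ _ ⟨n, x, ξ, rfl⟩ ⟨m, y, η, rfl⟩
  exact ⟨n + m, Fin.append x y, Fin.append ξ η, by simp [Fin.sum_univ_add]⟩

theorem form_conj (u v : PreTensor X π) : starRingEnd ℂ (form π v u) = form π u v := by
  refine PreTensor.induction u (by simp) (fun x ξ => ?_)
    fun u u' h h' => by simp only [map_add, LinearMap.add_apply, h, h']
  refine PreTensor.induction v (by simp) (fun y η => ?_)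
    fun v v' h h' => by simp only [map_add, LinearMap.add_apply, h, h']
  rw [form_tmul, form_tmul, inner_conj_symm, ← star_ip, map_star,
    ContinuousLinearMap.star_eq_adjoint, ContinuousLinearMap.adjoint_inner_left]

theorem inner_star_mul (a b : A) (ξ η : H) : ⟪ξ, π (star a * b) η⟫_ℂ = ⟪π a ξ, π b η⟫_ℂ := by
  rw [map_mul, map_star, ContinuousLinearMap.star_eq_adjoint]
  exact ContinuousLinearMap.adjoint_inner_right (π a) ξ (π b η)

theorem form_self_nonneg (u : PreTensor X π) : 0 ≤ RCLike.re (form π u u) := by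
  obtain ⟨n, x, ξ, rfl⟩ := PreTensor.exists_sum π u
  obtain ⟨B, hB⟩ := gram_eq (A := A) x
  have h1 : ∀ i j, ⟪ξ i, π (ip A (x i) (x j)) (ξ j)⟫_ℂ =
      ∑ k, ⟪π (B k i) (ξ i), π (B k j) (ξ j)⟫_ℂ := fun i j => by
    rw [hB, map_sum, sum_apply, inner_sum]
    exact Finset.sum_congr rfl fun k _ => inner_star_mul π _ _ _ _
  have h2 : form π (∑ i, preTmul π (x i) (ξ i)) (∑ i, preTmul π (x i) (ξ i)) =
      ∑ k, ⟪∑ i, π (B k i) (ξ i), ∑ i, π (B k i) (ξ i)⟫_ℂ := by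
    calc _ = ∑ i, ∑ j, ∑ k, ⟪π (B k i) (ξ i), π (B k j) (ξ j)⟫_ℂ := by
          rw [map_sum (form π), LinearMap.sum_apply]
          refine Finset.sum_congr rfl fun i _ => ?_
          rw [map_sum]
          refine Finset.sum_congr rfl fun j _ => ?_
          rw [form_tmul, h1]
      _ = ∑ i, ∑ k, ∑ j, ⟪π (B k i) (ξ i), π (B k j) (ξ j)⟫_ℂ :=
          Finset.sum_congr rfl fun i _ => Finset.sum_comm
      _ = ∑ k, ∑ i, ∑ j, ⟪π (B k i) (ξ i), π (B k j) (ξ j)⟫_ℂ := Finset.sum_comm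
      _ = _ := by
          refine Finset.sum_congr rfl fun k _ => ?_
          rw [sum_inner]
          refine Finset.sum_congr rfl fun i _ => ?_
          rw [inner_sum]
  rw [h2, map_sum]
  exact Finset.sum_nonneg fun k _ => inner_self_nonneg

/-- The semi-inner product of the algebraic tensor product. -/
@[reducible]
def preTensorCore : PreInnerProductSpace.Core ℂ (PreTensor X π) where
  inner u v := form π u v
  conj_inner_symm := form_conj π
  re_inner_nonneg := form_self_nonneg π
  add_left _ _ _ := by rw [map_add, LinearMap.add_apply]
  smul_left _ _ _ := by rw [map_smulₛₗ, LinearMap.smul_apply, smul_eq_mul]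

instance : SeminormedAddCommGroup (PreTensor X π) :=
  InnerProductSpace.Core.toSeminormedAddCommGroup (c := preTensorCore π)

instance : InnerProductSpace ℂ (PreTensor X π) := InnerProductSpace.ofCore (preTensorCore π)

variable (X) in
/-- The Hilbert space `X ⊗_A ℋ`: the Hausdorff completion of the algebraic tensor product in its
semi-inner product `⟪x ⊗ ξ, y ⊗ η⟫ = ⟪ξ, π ⟨x, y⟩ η⟫`. -/
abbrev IndSpace : Type _ := UniformSpace.Completion (PreTensor X π)

/-- The elementary tensor `x ⊗_A ξ` in `X ⊗_A ℋ`. -/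
def tmul (x : X) (ξ : H) : IndSpace X π := (preTmul π x ξ : PreTensor X π)

theorem inner_pre (u v : PreTensor X π) : ⟪u, v⟫_ℂ = form π u v := rfl

theorem inner_tmul (x : X) (ξ : H) (y : X) (η : H) :
    ⟪tmul π x ξ, tmul π y η⟫_ℂ = ⟪ξ, π (ip A x y) η⟫_ℂ := by
  rw [tmul, tmul, UniformSpace.Completion.inner_coe, inner_pre, form_tmul]

theorem norm_preTmul_le (x : X) (ξ : H) : ‖preTmul π x ξ‖ ≤ ‖x‖ * ‖ξ‖ := by
  refine abs_le_of_sq_le_sq' ?_ (by positivity) |>.2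
  rw [← inner_self_eq_norm_sq (𝕜 := ℂ), inner_pre, form_tmul]
  calc _ ≤ ‖⟪ξ, π (ip A x x) ξ⟫_ℂ‖ := RCLike.re_le_norm _
    _ ≤ ‖ξ‖ * (‖π (ip A x x)‖ * ‖ξ‖) := (norm_inner_le_norm _ _).trans
        (by gcongr; exact ContinuousLinearMap.le_opNorm _ _)
    _ ≤ ‖ξ‖ * (‖ip A x x‖ * ‖ξ‖) := by gcongr; exact NonUnitalStarAlgHom.norm_apply_le π _
    _ = (‖x‖ * ‖ξ‖) ^ 2 := by rw [← norm_sq_eq]; ring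

/-- The operator `T ⊗ 1` on the algebraic tensor product. -/
def preAmp (T : Adjointable A X) : PreTensor X π →ₗ[ℂ] PreTensor X π :=
  TensorProduct.map (T.toCLM : X →ₗ[ℂ] X) (LinearMap.id : H →ₗ[ℂ] H)

theorem preAmp_tmul (T : Adjointable A X) (x : X) (ξ : H) :
    preAmp π T (preTmul π x ξ) = preTmul π (T x) ξ := rfl

theorem preAmp_mul (S T : Adjointable A X) (u : PreTensor X π) :
    preAmp π (S * T) u = preAmp π S (preAmp π T u) := by
  refine PreTensor.induction u (by simp) (fun x ξ => ?_) fun u v h h' => by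
    simp only [map_add, h, h']
  simp only [preAmp_tmul, mul_apply]

theorem preAmp_adj (T : Adjointable A X) (u v : PreTensor X π) :
    ⟪preAmp π T u, v⟫_ℂ = ⟪u, preAmp π (star T) v⟫_ℂ := by
  refine PreTensor.induction u (by simp) (fun x ξ => ?_) fun u u' h h' => by
    simp only [map_add, inner_add_left, h, h']
  refine PreTensor.induction v (by simp) (fun y η => ?_) fun v v' h h' => by
    simp only [map_add, inner_add_right, h, h']
  simp only [preAmp_tmul, inner_pre, form_tmul, ip_adj_right]

theorem exists_preAmp_bound (u : PreTensor X π) :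
    ∃ K, 0 ≤ K ∧ ∀ T : Adjointable A X, ‖preAmp π T u‖ ≤ K * ‖T‖ := by
  refine PreTensor.induction u ⟨0, le_rfl, by simp⟩ (fun x ξ => ?_) ?_
  · refine ⟨‖x‖ * ‖ξ‖, by positivity, fun T => ?_⟩
    rw [preAmp_tmul]
    calc _ ≤ ‖T x‖ * ‖ξ‖ := norm_preTmul_le π _ _
      _ ≤ ‖T‖ * ‖x‖ * ‖ξ‖ := by gcongr; exact norm_apply_le T x
      _ = _ := by ring
  · rintro u v ⟨K, hK0, hK⟩ ⟨L, hL0, hL⟩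
    refine ⟨K + L, by positivity, fun T => ?_⟩
    rw [map_add, add_mul]
    exact (norm_add_le _ _).trans (add_le_add (hK T) (hL T))

theorem norm_preAmp_le (T : Adjointable A X) (u : PreTensor X π) :
    ‖preAmp π T u‖ ≤ ‖T‖ * ‖u‖ := by
  -- the powers of `S = T⋆ T` give `‖S u‖ ^ (2 ^ n) ‖u‖ ≤ K (‖S‖ ‖u‖) ^ (2 ^ n)` for all `n`
  have hsq : ∀ (R : Adjointable A X) (v : PreTensor X π),
      ‖preAmp π R v‖ ^ 2 ≤ ‖v‖ * ‖preAmp π (star R * R) v‖ := fun R v => by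
    rw [← inner_self_eq_norm_sq (𝕜 := ℂ), preAmp_adj, preAmp_mul]
    exact (RCLike.re_le_norm _).trans (norm_inner_le_norm _ _)
  set S := star T * T with hS
  have hSs : star S = S := by rw [hS, star_mul, star_star]
  have hpow : ∀ n : ℕ, ‖preAmp π S u‖ ^ 2 ^ n * ‖u‖ ≤ ‖preAmp π (S ^ 2 ^ n) u‖ * ‖u‖ ^ 2 ^ n := by
    intro n
    induction n with
    | zero => simp
    | succ n ih =>
      rcases eq_or_lt_of_le (norm_nonneg u) with h0 | h0
      · rw [← h0]
        simp
      have h1 := hsq (S ^ 2 ^ n) u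
      rw [star_pow, hSs, ← pow_add, ← two_mul, ← pow_succ'] at h1
      refine le_of_mul_le_mul_right ?_ h0
      calc _ = (‖preAmp π S u‖ ^ 2 ^ n * ‖u‖) ^ 2 := by ring
        _ ≤ (‖preAmp π (S ^ 2 ^ n) u‖ * ‖u‖ ^ 2 ^ n) ^ 2 := by gcongr
        _ = ‖preAmp π (S ^ 2 ^ n) u‖ ^ 2 * (‖u‖ ^ 2 ^ n) ^ 2 := by ring
        _ ≤ (‖u‖ * ‖preAmp π (S ^ 2 ^ (n + 1)) u‖) * (‖u‖ ^ 2 ^ n) ^ 2 := by gcongr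
        _ = _ := by ring
  have hSle : ‖preAmp π S u‖ ≤ ‖S‖ * ‖u‖ := by
    obtain ⟨K, hK0, hK⟩ := exists_preAmp_bound π u
    have hb : ∀ n : ℕ, ‖preAmp π S u‖ ^ 2 ^ n * ‖u‖ ≤ K * (‖S‖ * ‖u‖) ^ 2 ^ n := fun n => by
      refine (hpow n).trans ?_
      rw [mul_pow, ← mul_assoc]
      gcongr
      exact (hK _).trans (by gcongr; exact norm_pow_le' S (by positivity))
    by_contra! hlt
    have hSu : 0 < ‖preAmp π S u‖ := lt_of_le_of_lt (by positivity) hlt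
    rcases eq_or_lt_of_le (norm_nonneg u) with h0 | h0
    · have := hsq S u
      rw [← h0, zero_mul] at this
      exact absurd this (not_le.2 (by positivity))
    have hq : (‖S‖ * ‖u‖) / ‖preAmp π S u‖ < 1 := (div_lt_one hSu).2 hlt
    have ht : Filter.Tendsto (fun n : ℕ => K * ((‖S‖ * ‖u‖) / ‖preAmp π S u‖) ^ 2 ^ n)
        Filter.atTop (nhds (K * 0)) :=
      ((tendsto_pow_atTop_nhds_zero_of_lt_one (by positivity) hq).comp
        (tendsto_pow_atTop_atTop_of_one_lt one_lt_two)).const_mul K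
    have hle : ‖u‖ ≤ K * 0 := ge_of_tendsto' ht fun n => by
      rw [div_pow, ← mul_div_assoc, le_div_iff₀ (by positivity), mul_comm]
      exact hb n
    rw [mul_zero] at hle
    exact absurd hle (not_le.2 h0)
  refine abs_le_of_sq_le_sq' ?_ (by positivity) |>.2
  calc ‖preAmp π T u‖ ^ 2 ≤ ‖u‖ * ‖preAmp π S u‖ := hsq T u
    _ ≤ ‖u‖ * (‖S‖ * ‖u‖) := by gcongr
    _ = (‖T‖ * ‖u‖) ^ 2 := by rw [hS, CStarRing.norm_star_mul_self]; ring

/-- The operator `T ⊗ 1` on the algebraic tensor product, as a bounded operator. -/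
def preAmpL (T : Adjointable A X) : PreTensor X π →L[ℂ] PreTensor X π :=
  (preAmp π T).mkContinuous ‖T‖ (norm_preAmp_le π T)

/-- The operator `T ⊗ 1` on `X ⊗_A ℋ`. -/
def amp (T : Adjointable A X) : IndSpace X π →L[ℂ] IndSpace X π := (preAmpL π T).completion

theorem amp_coe (T : Adjointable A X) (u : PreTensor X π) :
    amp π T (u : IndSpace X π) = (preAmp π T u : PreTensor X π) := by
  rw [amp, ContinuousLinearMap.completion_apply_coe]
  rfl

theorem amp_tmul (T : Adjointable A X) (x : X) (ξ : H) :
    amp π T (tmul π x ξ) = tmul π (T x) ξ := by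
  rw [tmul, amp_coe, preAmp_tmul, tmul]

/-- The elementary tensors span a dense subspace: bounded operators that agree on them agree. -/
theorem clm_ext {E : Type*} [NormedAddCommGroup E] [NormedSpace ℂ E]
    {F G : IndSpace X π →L[ℂ] E} (h : ∀ x ξ, F (tmul π x ξ) = G (tmul π x ξ)) : F = G := by
  ext w
  refine UniformSpace.Completion.induction_on w (isClosed_eq F.continuous G.continuous) fun u => ?_
  refine PreTensor.induction u ?_ h fun u v h h' => ?_
  · rw [UniformSpace.Completion.coe_zero, map_zero, map_zero]
  · rw [UniformSpace.Completion.coe_add, map_add, map_add, h, h']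

theorem tmul_add_left (x y : X) (ξ : H) : tmul π (x + y) ξ = tmul π x ξ + tmul π y ξ := by
  rw [tmul, tmul, tmul, ← UniformSpace.Completion.coe_add]
  exact congrArg _ (TensorProduct.add_tmul x y ξ)

theorem tmul_smul_left (c : ℂ) (x : X) (ξ : H) : tmul π (c • x) ξ = c • tmul π x ξ := by
  rw [tmul, tmul, ← UniformSpace.Completion.coe_smul]
  rfl

variable (X) in
/-- The representation `T ↦ T ⊗ 1` of `ℒ(X)` on `X ⊗_A ℋ` given by Rieffel induction. -/
def rieffel : Adjointable A X →⋆ₙₐ[ℂ] (IndSpace X π →L[ℂ] IndSpace X π) where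
  toFun := amp π
  map_smul' c T := clm_ext π fun x ξ => by
    change amp π (c • T) _ = c • amp π T _
    rw [amp_tmul, amp_tmul, smul_apply, tmul_smul_left]
  map_zero' := clm_ext π fun x ξ => by
    rw [amp_tmul, zero_apply, ← zero_smul ℂ (0 : X), tmul_smul_left, zero_smul]
    rfl
  map_add' S T := clm_ext π fun x ξ => by
    change amp π (S + T) _ = amp π S _ + amp π T _
    rw [amp_tmul, amp_tmul, amp_tmul, add_apply, tmul_add_left]
  map_mul' S T := clm_ext π fun x ξ => by
    change amp π (S * T) _ = amp π S (amp π T _)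
    rw [amp_tmul, amp_tmul, amp_tmul, mul_apply]
  map_star' T := by
    refine (ContinuousLinearMap.eq_adjoint_iff _ _).2 fun v w => ?_
    refine UniformSpace.Completion.induction_on₂ v w ?_ fun u u' => ?_
    · exact isClosed_eq (by fun_prop) (by fun_prop)
    · rw [amp_coe, amp_coe, UniformSpace.Completion.inner_coe, UniformSpace.Completion.inner_coe,
        preAmp_adj, star_star]

/-- The representation `X-Ind π` of `A` on `X ⊗_A ℋ`, `(X-Ind π)(a) (x ⊗_A ξ) = (φ a x) ⊗_A ξ`, where
`φ : A → ℒ(X)` is the left action of the correspondence `X`. -/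
def ind (φ : A →⋆ₙₐ[ℂ] Adjointable A X) : A →⋆ₙₐ[ℂ] (IndSpace X π →L[ℂ] IndSpace X π) :=
  (rieffel X π).comp φ

theorem ind_tmul (φ : A →⋆ₙₐ[ℂ] Adjointable A X) (a : A) (x : X) (ξ : H) :
    ind π φ a (tmul π x ξ) = tmul π (φ a x) ξ := amp_tmul π (φ a) x ξ

end Induction

/-! ### Correspondences and their representations

An `A`-correspondence is a right Hilbert `A`-module `X` together with a `*`-homomorphism
`φ : A → ℒ(X)`, the left action. -/

section Correspondence

variable {A : Type*} [NonUnitalCStarAlgebra A] [PartialOrder A] [StarOrderedRing A]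
variable {X : Type*} [NormedAddCommGroup X] [NormedSpace ℂ X] [SMul Aᵐᵒᵖ X] [CStarModule Aᵐᵒᵖ X]
variable (φ : A →⋆ₙₐ[ℂ] Adjointable A X)

/-- The correspondence is nondegenerate, `φ(A) X = X`: the elements `φ a x` span a dense subspace
(by Cohen factorization, every element of `X` is then itself of the form `φ a x`). -/
def IsNondegenerate : Prop :=
  (Submodule.span ℂ {y : X | ∃ (a : A) (x : X), y = φ a x}).topologicalClosure = ⊤

/-- The Katsura ideal `J_X = φ⁻¹(𝒦(X)) ∩ (ker φ)^⊥`. -/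
def katsuraIdeal : Set A := {a | φ a ∈ Compacts A X ∧ ∀ b, φ b = 0 → a * b = 0}

/-- The correspondence is regular: `J_X = A`. -/
def IsRegular : Prop := katsuraIdeal φ = Set.univ

variable (H : Type*) [NormedAddCommGroup H] [InnerProductSpace ℂ H] [CompleteSpace H]

/-- A (Toeplitz) representation `(ψ, π)` of the correspondence on the Hilbert space `ℋ`. -/
structure Representation where
  /-- The linear map `ψ : X → B(ℋ)`. -/
  ψ : X →ₗ[ℂ] (H →L[ℂ] H)
  /-- The representation `π` of `A` on `ℋ`. -/
  π : A →⋆ₙₐ[ℂ] (H →L[ℂ] H)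
  map_left : ∀ a x, ψ (φ a x) = π a * ψ x
  star_mul : ∀ x y, star (ψ x) * ψ y = π (ip A x y)

variable {φ H}

/-- `(ψ, π)` is Cuntz-Pimsner covariant: `π a = ψ⁽¹⁾ (φ a)` for all `a ∈ J_X`, where `ψ⁽¹⁾` is the
(unique) `*`-homomorphism `𝒦(X) → B(ℋ)` with `ψ⁽¹⁾ θ_{x,y} = ψ x (ψ y)⋆`. -/
def Representation.IsCuntzPimsner (r : Representation φ H) : Prop :=
  ∃ ψ₁ : Compacts A X →⋆ₙₐ[ℂ] (H →L[ℂ] H),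
    (∀ x y, ψ₁ (theta A x y) = r.ψ x * star (r.ψ y)) ∧
    ∀ (a : A) (ha : a ∈ katsuraIdeal φ), r.π a = ψ₁ ⟨φ a, ha.1⟩

/-- The `C*`-algebra generated by `ψ(X) ∪ π(A)` in `B(ℋ)`. -/
def Representation.generated (r : Representation φ H) : NonUnitalStarSubalgebra ℂ (H →L[ℂ] H) :=
  (NonUnitalStarAlgebra.adjoin ℂ (Set.range r.ψ ∪ Set.range r.π)).topologicalClosure

/-- `(ψ, π)` is nondegenerate: the `C*`-algebra generated by `ψ(X) ∪ π(A)` acts nondegenerately. -/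
def Representation.IsNondegenerate (r : Representation φ H) : Prop :=
  (Submodule.span ℂ {η : H | ∃ b ∈ r.generated, ∃ ξ : H, η = b ξ}).topologicalClosure = ⊤

variable (φ H)

/-- A pair `(π, V)` of a representation `π` of `A` on `ℋ` and a unitary `V : X ⊗_A ℋ → ℋ` that
implements a unitary equivalence between `X-Ind π` and `π`. -/
structure EquivalencePair where
  /-- The representation `π` of `A` on `ℋ`. -/
  π : A →⋆ₙₐ[ℂ] (H →L[ℂ] H)
  /-- The unitary `V : X ⊗_A ℋ → ℋ`. -/
  V : IndSpace X π ≃ₗᵢ[ℂ] H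
  intertwines : ∀ (a : A) (w : IndSpace X π), V (ind π φ a w) = π a (V w)

end Correspondence

end CStarCorr

end

/-! The relation `V (x ⊗ ξ) = ψ x ξ` determines `ψ` from `V`, and determines `V` from `ψ` because
elementary tensors span a dense subspace (`clm_ext`). What has to be shown is that the conditions on
the two sides correspond.

From `(ψ, π)` to `V`: the identity `ψ(x)⋆ψ(y) = π⟨x, y⟩` says exactly that `x ⊗ ξ ↦ ψ x ξ` preserves
the inner product (`inner_preV`), so it extends to an isometry `V`, and `ψ(ax) = π(a)ψ(x)` gives the
intertwining relation. The substance is surjectivity. A vector `η` orthogonal to the range is killed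
by every `ψ(x)⋆`, hence by every `ψ⁽¹⁾(θ_{x,y}) = ψ(x)ψ(y)⋆`, hence by `ψ⁽¹⁾(𝒦(X))`. Covariance and
`J_X = A` then give `π(A)η = 0`, and `‖ψ(x)η‖² = ⟪η, π⟨x, x⟩η⟫` gives `ψ(X)η = 0`. The generated
`C*`-algebra thus kills `η`, so `η = 0` by nondegeneracy (`IsNondegenerate.eq_zero`).

From `V` to `(ψ, π)`: the homomorphism `k ↦ V (k ⊗ 1) V⋆` sends `θ_{x,y}` to `ψ(x)ψ(y)⋆`
(`compactsHom_theta`), so it is `ψ⁽¹⁾`, and the intertwining relation reads `π(a) = ψ⁽¹⁾(φ(a))`.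
Surjectivity of `V` makes `ψ(X)ℋ` total in `ℋ`. -/

open scoped InnerProductSpace RightActions TensorProduct

noncomputable section

namespace CStarCorr

set_option linter.unusedSectionVars false

/-! ### Elementary tensors in `X ⊗_A ℋ`: bilinearity, balancing and totality. -/

section Balanced

variable {A : Type*} [NonUnitalCStarAlgebra A] [PartialOrder A] [StarOrderedRing A]
variable {X : Type*} [NormedAddCommGroup X] [NormedSpace ℂ X] [SMul Aᵐᵒᵖ X] [CStarModule Aᵐᵒᵖ X]
variable {H : Type*} [NormedAddCommGroup H] [InnerProductSpace ℂ H] [CompleteSpace H]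
variable (π : A →⋆ₙₐ[ℂ] (H →L[ℂ] H))

theorem tmul_add_right (x : X) (ξ η : H) : tmul π x (ξ + η) = tmul π x ξ + tmul π x η := by
  rw [tmul, tmul, tmul, ← UniformSpace.Completion.coe_add]
  exact congrArg _ (TensorProduct.tmul_add x ξ η)

theorem tmul_smul_right (c : ℂ) (x : X) (ξ : H) : tmul π x (c • ξ) = c • tmul π x ξ := by
  rw [tmul, tmul, ← UniformSpace.Completion.coe_smul]
  exact congrArg _ (TensorProduct.tmul_smul c x ξ)

theorem norm_tmul_le (x : X) (ξ : H) : ‖tmul π x ξ‖ ≤ ‖x‖ * ‖ξ‖ := by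
  rw [tmul, UniformSpace.Completion.norm_coe]
  exact norm_preTmul_le π x ξ

/-- The tensor product `X ⊗_A ℋ` is balanced over `A`. -/
theorem tmul_op_smul (x : X) (a : A) (ξ : H) : tmul π (x <• a) ξ = tmul π x (π a ξ) := by
  -- The algebraic tensor product is over `ℂ` only, so balancing appears after null vectors are
  -- divided out: all four terms of the squared norm of the difference equal `⟪π a ξ, π⟨x, x⟩ π a
  -- ξ⟫`, and they cancel.
  rw [← sub_eq_zero, ← inner_self_eq_zero (𝕜 := ℂ)]
  have h : ∀ b, π (b * a) ξ = π b (π a ξ) := fun b => by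
    rw [map_mul]
    rfl
  simp only [inner_sub_left, inner_sub_right, inner_tmul, ip_op_smul_left, ip_op_smul_right,
    mul_assoc, inner_star_mul, h, sub_self]

/-- The linear map `ξ ↦ x ⊗_A ξ`, as a bounded operator. -/
def creation (x : X) : H →L[ℂ] IndSpace X π :=
  LinearMap.mkContinuous
    { toFun := tmul π x
      map_add' := tmul_add_right π x
      map_smul' := fun c ξ => tmul_smul_right π c x ξ } ‖x‖ (norm_tmul_le π x)

theorem creation_apply (x : X) (ξ : H) : creation π x ξ = tmul π x ξ := rfl

/-- A linear subspace of `X ⊗_A ℋ` containing the elementary tensors is dense. -/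
theorem span_tmul_topologicalClosure :
    (Submodule.span ℂ {w | ∃ (x : X) (ξ : H), w = tmul π x ξ}).topologicalClosure = ⊤ := by
  refine Submodule.dense_iff_topologicalClosure_eq_top.1 ?_
  refine UniformSpace.Completion.denseRange_coe.mono ?_
  rintro _ ⟨u, rfl⟩
  refine PreTensor.induction u ?_ (fun x ξ => Submodule.subset_span ⟨x, ξ, rfl⟩)
    fun u v hu hv => ?_
  · rw [UniformSpace.Completion.coe_zero]
    exact zero_mem _
  · rw [UniformSpace.Completion.coe_add]
    exact add_mem hu hv

end Balanced

/-! ### Operators vanishing at a vector together with their adjoints. -/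

section Annihilator

variable {H : Type*} [NormedAddCommGroup H] [InnerProductSpace ℂ H] [CompleteSpace H]

/-- The `*`-algebra of the operators `b` such that `b` and `b⋆` vanish at `η`. -/
def annihilatorAt (η : H) : NonUnitalStarSubalgebra ℂ (H →L[ℂ] H) where
  -- The condition on `star b` makes the set closed under adjoints; it is also the half that gives
  -- `⟪b ξ, η⟫ = 0`.
  carrier := {b | b η = 0 ∧ star b η = 0}
  add_mem' := by
    rintro b c ⟨hb, hb'⟩ ⟨hc, hc'⟩
    simp [hb, hb', hc, hc']
  zero_mem' := by simp
  mul_mem' := by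
    rintro b c ⟨hb, hb'⟩ ⟨hc, hc'⟩
    simp [hb', hc, star_mul]
  smul_mem' := by
    rintro c b ⟨hb, hb'⟩
    simp [hb, hb', star_smul]
  star_mem' := by
    rintro b ⟨hb, hb'⟩
    exact ⟨hb', by rwa [star_star]⟩

theorem mem_annihilatorAt {η : H} {b : H →L[ℂ] H} :
    b ∈ annihilatorAt η ↔ b η = 0 ∧ star b η = 0 := Iff.rfl

theorem isClosed_annihilatorAt (η : H) : IsClosed (annihilatorAt η : Set (H →L[ℂ] H)) := by
  have h : Continuous fun b : H →L[ℂ] H => b η :=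
    (ContinuousLinearMap.apply ℂ H η).continuous
  exact (isClosed_eq h continuous_const).inter
    (isClosed_eq (h.comp continuous_star) continuous_const)

end Annihilator

/-! ### Representations of `𝒦(X)` are determined by the operators `θ_{x,y}`. -/

section Compacts

variable {A : Type*} [NonUnitalCStarAlgebra A] [PartialOrder A] [StarOrderedRing A]
variable {X : Type*} [NormedAddCommGroup X] [NormedSpace ℂ X] [CompleteSpace X]
variable [SMul Aᵐᵒᵖ X] [CStarModule Aᵐᵒᵖ X]
variable {H : Type*} [NormedAddCommGroup H] [InnerProductSpace ℂ H] [CompleteSpace H]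

/-- A `*`-homomorphism between `C*`-algebras is contractive. Closedness of `𝒦(X)` in the complete
algebra `ℒ(X)` is what makes its domain a `C*`-algebra. -/
theorem continuous_compacts_hom (ρ : Compacts A X →⋆ₙₐ[ℂ] (H →L[ℂ] H)) : Continuous ρ := by
  have : IsClosed (Compacts A X : Set (Adjointable A X)) :=
    (finiteRank A X).isClosed_topologicalClosure
  exact AddMonoidHomClass.continuous_of_bound ρ 1 fun k => by
    simpa only [one_mul] using NonUnitalStarAlgHom.norm_apply_le ρ k

/-- A representation of `𝒦(X)` vanishes at a vector at which all `θ_{x,y}` vanish. -/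
theorem compacts_hom_apply_eq_zero (ρ : Compacts A X →⋆ₙₐ[ℂ] (H →L[ℂ] H)) {η : H}
    (h : ∀ x y, ρ (theta A x y) η = 0) (k : Compacts A X) : ρ k η = 0 := by
  -- Since `ρ` is defined only on `𝒦(X)`, the span induction has to carry the membership proof along
  -- with the operator.
  have hfin : ∀ T (hT : T ∈ finiteRank A X),
      ρ ⟨T, (finiteRank A X).le_topologicalClosure hT⟩ η = 0 := by
    intro T hT
    change T ∈ Submodule.span ℂ (Set.range fun p : X × X => rankOne A p.1 p.2) at hT
    induction hT using Submodule.span_induction with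
    | mem T hT =>
      obtain ⟨p, rfl⟩ := hT
      exact h p.1 p.2
    | zero => exact congrArg (fun b : H →L[ℂ] H => b η) (map_zero ρ)
    | add S T hS hT ihS ihT =>
      refine (congrArg (fun b : H →L[ℂ] H => b η)
        (map_add ρ ⟨S, (finiteRank A X).le_topologicalClosure hS⟩
          ⟨T, (finiteRank A X).le_topologicalClosure hT⟩)).trans ?_
      exact (congrArg₂ (· + ·) ihS ihT).trans (add_zero 0)
    | smul c T hT ih =>
      refine (congrArg (fun b : H →L[ℂ] H => b η)
        (map_smul ρ c ⟨T, (finiteRank A X).le_topologicalClosure hT⟩)).trans ?_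
      exact (congrArg (c • ·) ih).trans (smul_zero c)
  obtain ⟨u, hu, hlim⟩ := mem_closure_iff_seq_limit.1
    (show (k : Adjointable A X) ∈ closure (finiteRank A X : Set (Adjointable A X)) from k.2)
  have hv : Filter.Tendsto
      (fun n => (⟨u n, (finiteRank A X).le_topologicalClosure (hu n)⟩ : Compacts A X))
      Filter.atTop (nhds k) := tendsto_subtype_rng.2 hlim
  have hρ := ((ContinuousLinearMap.apply ℂ H η).continuous.comp
    (continuous_compacts_hom ρ)).continuousAt.tendsto.comp hv
  refine tendsto_nhds_unique hρ (tendsto_const_nhds.congr fun n => ?_)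
  exact (hfin (u n) (hu n)).symm

end Compacts

/-! ### From a covariant representation to a unitary. -/

section RepresentationToUnitary

variable {A : Type*} [NonUnitalCStarAlgebra A] [PartialOrder A] [StarOrderedRing A]
variable {X : Type*} [NormedAddCommGroup X] [NormedSpace ℂ X] [SMul Aᵐᵒᵖ X] [CStarModule Aᵐᵒᵖ X]
variable {φ : A →⋆ₙₐ[ℂ] Adjointable A X}
variable {H : Type*} [NormedAddCommGroup H] [InnerProductSpace ℂ H] [CompleteSpace H]

namespace Representation

theorem ext {r s : Representation φ H} (hψ : r.ψ = s.ψ) (hπ : r.π = s.π) : r = s := by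
  cases r
  cases s
  congr

variable (r : Representation φ H)

theorem inner_ψ (x y : X) (ξ η : H) : ⟪r.ψ x ξ, r.ψ y η⟫_ℂ = ⟪ξ, r.π (ip A x y) η⟫_ℂ := by
  rw [← r.star_mul, ContinuousLinearMap.star_eq_adjoint]
  exact (ContinuousLinearMap.adjoint_inner_right (r.ψ x) ξ (r.ψ y η)).symm

/-- The map `x ⊗ ξ ↦ ψ x ξ` on the algebraic tensor product. -/
def preV : PreTensor X r.π →ₗ[ℂ] H :=
  TensorProduct.lift ((ContinuousLinearMap.coeLM ℂ).comp r.ψ)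

theorem preV_tmul (x : X) (ξ : H) : r.preV (preTmul r.π x ξ) = r.ψ x ξ := rfl

/-- On elementary tensors this is `ψ(x)⋆ψ(y) = π⟨x, y⟩`. It makes the map isometric for the
seminorm, so null vectors go to zero and the map passes to the completion. -/
theorem inner_preV (u v : PreTensor X r.π) : ⟪r.preV u, r.preV v⟫_ℂ = ⟪u, v⟫_ℂ := by
  refine PreTensor.induction u (by simp) (fun x ξ => ?_) fun u u' h h' => by
    simp only [map_add, inner_add_left, h, h']
  refine PreTensor.induction v (by simp) (fun y η => ?_) fun v v' h h' => by
    simp only [map_add, inner_add_right, h, h']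
  rw [preV_tmul, preV_tmul, inner_ψ, inner_pre, form_tmul]

theorem norm_preV (u : PreTensor X r.π) : ‖r.preV u‖ = ‖u‖ := by
  rw [norm_eq_sqrt_re_inner (𝕜 := ℂ), norm_eq_sqrt_re_inner (𝕜 := ℂ), inner_preV]

/-- The isometry `x ⊗_A ξ ↦ ψ x ξ` on `X ⊗_A ℋ`. -/
def isometryV : IndSpace X r.π →ₗᵢ[ℂ] H :=
  let f : PreTensor X r.π →L[ℂ] H := r.preV.mkContinuous 1 fun u => by rw [norm_preV, one_mul]
  let F : IndSpace X r.π →L[ℂ] H := f.extend UniformSpace.Completion.toComplL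
  { toLinearMap := F
    norm_map' := fun w => by
      have hF : ∀ u : PreTensor X r.π, F u = r.preV u := fun u =>
        f.extend_eq UniformSpace.Completion.denseRange_coe
          (UniformSpace.Completion.isUniformInducing_coe _) u
      refine UniformSpace.Completion.induction_on w
        (isClosed_eq F.continuous.norm continuous_norm) fun u => ?_
      exact (congrArg norm (hF u)).trans
        ((r.norm_preV u).trans (UniformSpace.Completion.norm_coe u).symm) }

theorem isometryV_tmul (x : X) (ξ : H) : r.isometryV (tmul r.π x ξ) = r.ψ x ξ :=
  ContinuousLinearMap.extend_eq (r.preV.mkContinuous 1 fun u => by rw [norm_preV, one_mul])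
    UniformSpace.Completion.denseRange_coe
    (UniformSpace.Completion.isUniformInducing_coe _) (preTmul r.π x ξ)

theorem isometryV_ind (a : A) (w : IndSpace X r.π) :
    r.isometryV (ind r.π φ a w) = r.π a (r.isometryV w) := by
  have h : r.isometryV.toContinuousLinearMap.comp (ind r.π φ a) =
      (r.π a).comp r.isometryV.toContinuousLinearMap := clm_ext r.π fun x ξ => by
    change r.isometryV (ind r.π φ a (tmul r.π x ξ)) = r.π a (r.isometryV (tmul r.π x ξ))
    rw [ind_tmul, isometryV_tmul, isometryV_tmul, r.map_left]
    rfl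
  exact DFunLike.congr_fun h w

variable {r}

/-- Covariance puts `π(a)` in the image of `ψ⁽¹⁾` for every `a`, because `J_X = A`; and `ψ⁽¹⁾` kills
`η` as soon as all `ψ(x)ψ(y)⋆` do. -/
theorem IsCuntzPimsner.π_apply_eq_zero [CompleteSpace X] (hcp : r.IsCuntzPimsner)
    (hreg : IsRegular φ) {η : H} (h : ∀ x, star (r.ψ x) η = 0) (a : A) : r.π a η = 0 := by
  obtain ⟨ρ, hρ, hπ⟩ := hcp
  rw [hπ a (hreg ▸ Set.mem_univ a)]
  refine compacts_hom_apply_eq_zero ρ (fun x y => ?_) _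
  rw [hρ]
  change r.ψ x (star (r.ψ y) η) = 0
  rw [h, map_zero]

/-- Both `ψ(X)` and `π(A)`, with their adjoints, kill `η`; hence so does the closed `*`-algebra they
generate, and `η` is orthogonal to the dense span of its ranges. -/
theorem IsNondegenerate.eq_zero [CompleteSpace X] (hnd : r.IsNondegenerate)
    (hcp : r.IsCuntzPimsner) (hreg : IsRegular φ) {η : H} (h : ∀ x, star (r.ψ x) η = 0) :
    η = 0 := by
  have hπ := hcp.π_apply_eq_zero hreg h
  have hψ : ∀ x, r.ψ x η = 0 := fun x => by
    rw [← inner_self_eq_zero (𝕜 := ℂ), inner_ψ, hπ, inner_zero_right]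
  have hgen : r.generated ≤ annihilatorAt η := by
    refine NonUnitalStarSubalgebra.topologicalClosure_minimal _
      (NonUnitalStarAlgebra.adjoin_le ?_) (isClosed_annihilatorAt η)
    rintro _ (⟨x, rfl⟩ | ⟨a, rfl⟩)
    · exact ⟨hψ x, h x⟩
    · exact ⟨hπ a, by rw [← map_star]; exact hπ (star a)⟩
  have hbot := (Submodule.topologicalClosure_eq_top_iff).1 hnd
  rw [← Submodule.mem_bot ℂ, ← hbot, Submodule.mem_orthogonal]
  intro ζ hζ
  induction hζ using Submodule.span_induction with
  | mem ζ hζ =>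
    obtain ⟨b, hb, ξ, rfl⟩ := hζ
    -- `⟪b ξ, η⟫ = ⟪ξ, b⋆ η⟫`, and `b⋆` kills `η`.
    rw [← ContinuousLinearMap.adjoint_inner_right, ← ContinuousLinearMap.star_eq_adjoint,
      (hgen hb).2, inner_zero_right]
  | zero => exact inner_zero_left η
  | add ζ ζ' _ _ ih ih' => rw [inner_add_left, ih, ih', add_zero]
  | smul c ζ _ ih => rw [inner_smul_left, ih, mul_zero]

/-- The range of an isometry on a complete space is closed, so it suffices that its orthogonal
complement vanishes. -/
theorem IsNondegenerate.isometryV_surjective [CompleteSpace X] (hnd : r.IsNondegenerate)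
    (hcp : r.IsCuntzPimsner) (hreg : IsRegular φ) : Function.Surjective r.isometryV := by
  have hclosed : IsClosed (LinearMap.range r.isometryV.toLinearMap : Set H) := by
    rw [LinearMap.coe_range]
    exact r.isometryV.isometry.isClosedEmbedding.isClosed_range
  have htop : LinearMap.range r.isometryV.toLinearMap = ⊤ := by
    rw [← hclosed.submodule_topologicalClosure_eq, Submodule.topologicalClosure_eq_top_iff,
      Submodule.eq_bot_iff]
    intro η hη
    refine hnd.eq_zero hcp hreg fun x => ?_
    rw [← inner_self_eq_zero (𝕜 := ℂ)]
    -- Only the right-hand factor is moved across: `‖ψ(x)⋆η‖² = ⟪ψ(x)ψ(x)⋆η, η⟫ = ⟪V (x ⊗ ψ(x)⋆η),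
    -- η⟫`, which is zero because `η` is orthogonal to the range.
    nth_rw 2 [ContinuousLinearMap.star_eq_adjoint]
    rw [ContinuousLinearMap.adjoint_inner_right, ← isometryV_tmul]
    exact (Submodule.mem_orthogonal _ _).1 hη _ ⟨_, rfl⟩
  exact LinearMap.range_eq_top.1 htop

/-- The pair `(π, V)` with `V (x ⊗_A ξ) = ψ x ξ` of a nondegenerate Cuntz-Pimsner covariant
representation `(ψ, π)` of a regular correspondence. -/
def toEquivalencePair [CompleteSpace X] (r : Representation φ H) (hreg : IsRegular φ)
    (hcp : r.IsCuntzPimsner) (hnd : r.IsNondegenerate) : EquivalencePair φ H where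
  π := r.π
  V := LinearIsometryEquiv.ofSurjective r.isometryV (hnd.isometryV_surjective hcp hreg)
  intertwines := r.isometryV_ind

theorem toEquivalencePair_V_tmul [CompleteSpace X] (r : Representation φ H) (hreg : IsRegular φ)
    (hcp : r.IsCuntzPimsner) (hnd : r.IsNondegenerate) (x : X) (ξ : H) :
    (r.toEquivalencePair hreg hcp hnd).V (tmul r.π x ξ) = r.ψ x ξ :=
  r.isometryV_tmul x ξ

end Representation

end RepresentationToUnitary

/-! ### From an intertwining unitary to a covariant representation. -/

section UnitaryToRepresentation

variable {A : Type*} [NonUnitalCStarAlgebra A] [PartialOrder A] [StarOrderedRing A]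
variable {X : Type*} [NormedAddCommGroup X] [NormedSpace ℂ X] [SMul Aᵐᵒᵖ X] [CStarModule Aᵐᵒᵖ X]
variable {φ : A →⋆ₙₐ[ℂ] Adjointable A X}
variable {H : Type*} [NormedAddCommGroup H] [InnerProductSpace ℂ H] [CompleteSpace H]

namespace EquivalencePair

/-- The domain of `V` depends on `π`, so the two unitaries become comparable only once the
representations are identified; density of elementary tensors then suffices. -/
theorem ext_of_tmul {p q : EquivalencePair φ H} (hπ : p.π = q.π)
    (hV : ∀ x ξ, p.V (tmul p.π x ξ) = q.V (tmul q.π x ξ)) : p = q := by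
  obtain ⟨π, V, hp⟩ := p
  obtain ⟨π', V', hq⟩ := q
  obtain rfl : π = π' := hπ
  obtain rfl : V = V' := LinearIsometryEquiv.ext fun w => DFunLike.congr_fun
    (clm_ext π (F := V.toContinuousLinearEquiv.toContinuousLinearMap)
      (G := V'.toContinuousLinearEquiv.toContinuousLinearMap) hV) w
  rfl

variable (p : EquivalencePair φ H)

/-- The linear map `ψ : X → B(ℋ)` with `ψ x ξ = V (x ⊗_A ξ)`. -/
def toLinearMap : X →ₗ[ℂ] (H →L[ℂ] H) where
  toFun x := p.V.toContinuousLinearEquiv.toContinuousLinearMap.comp (creation p.π x)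
  map_add' x y := ContinuousLinearMap.ext fun ξ => by
    change p.V (tmul p.π (x + y) ξ) = p.V (tmul p.π x ξ) + p.V (tmul p.π y ξ)
    rw [tmul_add_left, map_add]
  map_smul' c x := ContinuousLinearMap.ext fun ξ => by
    change p.V (tmul p.π (c • x) ξ) = c • p.V (tmul p.π x ξ)
    rw [tmul_smul_left, map_smul]

theorem toLinearMap_apply (x : X) (ξ : H) : p.toLinearMap x ξ = p.V (tmul p.π x ξ) := rfl

/-- `V` preserves inner products, and `⟪x ⊗ ξ, y ⊗ η⟫ = ⟪ξ, π⟨x, y⟩η⟫` by construction. -/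
theorem star_toLinearMap_mul (x y : X) :
    star (p.toLinearMap x) * p.toLinearMap y = p.π (ip A x y) := by
  refine ContinuousLinearMap.ext fun η => ext_inner_left ℂ fun ξ => ?_
  rw [ContinuousLinearMap.star_eq_adjoint]
  change ⟪ξ, ContinuousLinearMap.adjoint (p.toLinearMap x) (p.toLinearMap y η)⟫_ℂ = _
  rw [ContinuousLinearMap.adjoint_inner_right, toLinearMap_apply, toLinearMap_apply,
    LinearIsometryEquiv.inner_map_map, inner_tmul]

/-- The representation `(ψ, π)` with `ψ x ξ = V (x ⊗_A ξ)`. -/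
def toRepresentation : Representation φ H where
  ψ := p.toLinearMap
  π := p.π
  map_left a x := ContinuousLinearMap.ext fun ξ => by
    change p.V (tmul p.π (φ a x) ξ) = p.π a (p.V (tmul p.π x ξ))
    rw [← ind_tmul, p.intertwines]
  star_mul := p.star_toLinearMap_mul

theorem toRepresentation_ψ_apply (x : X) (ξ : H) :
    p.toRepresentation.ψ x ξ = p.V (tmul p.π x ξ) := rfl

/-- The operator `V T V⋆` on `ℋ`. -/
def conj (T : IndSpace X p.π →L[ℂ] IndSpace X p.π) : H →L[ℂ] H :=
  p.V.toContinuousLinearEquiv.toContinuousLinearMap.comp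
    (T.comp p.V.symm.toContinuousLinearEquiv.toContinuousLinearMap)

theorem conj_apply (T : IndSpace X p.π →L[ℂ] IndSpace X p.π) (ζ : H) :
    p.conj T ζ = p.V (T (p.V.symm ζ)) := rfl

theorem conj_star (T : IndSpace X p.π →L[ℂ] IndSpace X p.π) :
    p.conj (star T) = star (p.conj T) := by
  refine (ContinuousLinearMap.eq_adjoint_iff _ _).2 fun ξ η => ?_
  rw [conj_apply, conj_apply, LinearIsometryEquiv.inner_map_eq_flip,
    ContinuousLinearMap.star_eq_adjoint, ContinuousLinearMap.adjoint_inner_left,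
    ← LinearIsometryEquiv.inner_map_map p.V, LinearIsometryEquiv.apply_symm_apply]

/-- The representation `k ↦ V (k ⊗ 1) V⋆` of `𝒦(X)` on `ℋ`. -/
def compactsHom : Compacts A X →⋆ₙₐ[ℂ] (H →L[ℂ] H) where
  toFun k := p.conj (rieffel X p.π k)
  map_smul' c k := ContinuousLinearMap.ext fun ζ => by
    change p.V (rieffel X p.π (c • (k : Adjointable A X)) _) = c • p.V (rieffel X p.π k _)
    rw [map_smul (rieffel X p.π)]
    exact map_smul p.V c _
  map_zero' := ContinuousLinearMap.ext fun ζ => by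
    change p.V (rieffel X p.π 0 _) = 0
    rw [map_zero]
    exact map_zero p.V
  map_add' k l := ContinuousLinearMap.ext fun ζ => by
    change p.V (rieffel X p.π ((k : Adjointable A X) + l) _) =
      p.V (rieffel X p.π k _) + p.V (rieffel X p.π l _)
    rw [map_add (rieffel X p.π)]
    exact map_add p.V _ _
  map_mul' k l := ContinuousLinearMap.ext fun ζ => by
    change p.V (rieffel X p.π ((k : Adjointable A X) * l) _) =
      p.V (rieffel X p.π k (p.V.symm (p.V (rieffel X p.π l _))))
    rw [map_mul, LinearIsometryEquiv.symm_apply_apply]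
    rfl
  map_star' k := by
    change p.conj (rieffel X p.π (star (k : Adjointable A X))) = _
    rw [map_star, conj_star]

theorem compactsHom_apply (k : Compacts A X) (w : IndSpace X p.π) :
    p.compactsHom k (p.V w) = p.V (rieffel X p.π k w) := by
  change p.V (rieffel X p.π k (p.V.symm (p.V w))) = _
  rw [LinearIsometryEquiv.symm_apply_apply]

/-- On `V (z ⊗ ξ) = ψ(z)ξ` the right side is `ψ(x)ψ(y)⋆ψ(z)ξ = ψ(x)π⟨y, z⟩ξ = V (x ⊗ π⟨y, z⟩ξ)`.
Balancing turns this into `V (x⟨y, z⟩ ⊗ ξ) = V (θ_{x,y}z ⊗ ξ)`. -/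
theorem compactsHom_theta (x y : X) : p.compactsHom (theta A x y) =
    p.toRepresentation.ψ x * star (p.toRepresentation.ψ y) := by
  refine ContinuousLinearMap.ext fun ζ => ?_
  obtain ⟨w, rfl⟩ := p.V.surjective ζ
  rw [compactsHom_apply]
  refine DFunLike.congr_fun (clm_ext p.π
    (F := p.V.toContinuousLinearEquiv.toContinuousLinearMap.comp
      (rieffel X p.π (theta A x y : Adjointable A X)))
    (G := (p.toRepresentation.ψ x * star (p.toRepresentation.ψ y)).comp
      p.V.toContinuousLinearEquiv.toContinuousLinearMap) fun z ξ => ?_) w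
  have h := DFunLike.congr_fun (p.toRepresentation.star_mul y z) ξ
  change star (p.toRepresentation.ψ y) (p.V (tmul p.π z ξ)) = p.π (ip A y z) ξ at h
  change p.V (amp p.π (rankOne A x y) (tmul p.π z ξ)) =
    p.toRepresentation.ψ x (star (p.toRepresentation.ψ y) (p.V (tmul p.π z ξ)))
  rw [h, amp_tmul, rankOne_apply, tmul_op_smul, toRepresentation_ψ_apply]

/-- `X-Ind π (a)` is `φ(a) ⊗ 1`, so the intertwining relation says `π(a) = V (φ(a) ⊗ 1) V⋆`, which
is covariance for `compactsHom`. -/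
theorem isCuntzPimsner_toRepresentation : p.toRepresentation.IsCuntzPimsner := by
  refine ⟨p.compactsHom, p.compactsHom_theta, fun a ha => ContinuousLinearMap.ext fun ζ => ?_⟩
  obtain ⟨w, rfl⟩ := p.V.surjective ζ
  rw [compactsHom_apply]
  exact (p.intertwines a w).symm

/-- The vectors `ψ(x)ξ = V (x ⊗ ξ)` already span a dense subspace, being the image of a total set
under a continuous surjection. -/
theorem isNondegenerate_toRepresentation : p.toRepresentation.IsNondegenerate := by
  refine Submodule.dense_iff_topologicalClosure_eq_top.1 ?_
  have hd := p.V.surjective.denseRange.dense_image p.V.continuous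
    (Submodule.dense_iff_topologicalClosure_eq_top.2
      (span_tmul_topologicalClosure (X := X) p.π))
  refine hd.mono ?_
  rintro _ ⟨w, hw, rfl⟩
  induction hw using Submodule.span_induction with
  | mem w hw =>
    obtain ⟨x, ξ, rfl⟩ := hw
    exact Submodule.subset_span ⟨p.toRepresentation.ψ x,
      NonUnitalStarSubalgebra.le_topologicalClosure _
        (NonUnitalStarAlgebra.subset_adjoin ℂ _ (Or.inl ⟨x, rfl⟩)), ξ, rfl⟩
  | zero => rw [map_zero]; exact zero_mem _
  | add v w _ _ hv hw => rw [map_add]; exact add_mem hv hw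
  | smul c w _ hw => rw [map_smul]; exact Submodule.smul_mem _ c hw

end EquivalencePair

end UnitaryToRepresentation

end CStarCorr

end

theorem mainTheorem7
    {A : Type*} [NonUnitalCStarAlgebra A] [PartialOrder A] [StarOrderedRing A]
    {X : Type*} [NormedAddCommGroup X] [NormedSpace ℂ X] [CompleteSpace X]
    [SMul Aᵐᵒᵖ X] [CStarModule Aᵐᵒᵖ X]
    (φ : A →⋆ₙₐ[ℂ] CStarCorr.Adjointable A X)
    (hnd : CStarCorr.IsNondegenerate φ) (hreg : CStarCorr.IsRegular φ)
    (H : Type*) [NormedAddCommGroup H] [InnerProductSpace ℂ H] [CompleteSpace H] :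
    ∃ e : {r : CStarCorr.Representation φ H // r.IsCuntzPimsner ∧ r.IsNondegenerate} ≃
        CStarCorr.EquivalencePair φ H,
      ∀ r, (e r).π = r.1.π ∧
        ∀ (x : X) (ξ : H), (e r).V (CStarCorr.tmul (e r).π x ξ) = r.1.ψ x ξ :=
  ⟨{ toFun := fun r => r.1.toEquivalencePair hreg r.2.1 r.2.2
     invFun := fun p => ⟨p.toRepresentation, p.isCuntzPimsner_toRepresentation,
       p.isNondegenerate_toRepresentation⟩
     -- Both constructions leave `π` unchanged, so each round trip reduces to the single formula `V
     -- (x ⊗ ξ) = ψ x ξ`.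
     left_inv := fun r => Subtype.ext (CStarCorr.Representation.ext
       (LinearMap.ext fun x => ContinuousLinearMap.ext fun ξ =>
         r.1.toEquivalencePair_V_tmul hreg r.2.1 r.2.2 x ξ) rfl)
     right_inv := fun p => CStarCorr.EquivalencePair.ext_of_tmul rfl fun x ξ =>
       p.toRepresentation.toEquivalencePair_V_tmul hreg p.isCuntzPimsner_toRepresentation
         p.isNondegenerate_toRepresentation x ξ },
    fun r => ⟨rfl, r.1.toEquivalencePair_V_tmul hreg r.2.1 r.2.2⟩⟩
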